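/- **Conventions.** A filtration $F^\bullet$ of a complex vector space $V$ is a decreasing family of subspaces $F^pV$, $p\in\mathbb Z$; it is finite if $F^aV=V$ and $F^bV=0$ for some $a,b$. A pure $\mathbb C$-Hodge structure of weight $n$ is a finite dimensional complex vector space $V$ with two finite filtrations $F,\hat F$ such that $V=F^pV\oplus\hat F^qV$ whenever $p+q=n+1$. A $\mathbb C$-mixed Hodge structure is a finite dimensional complex vector space $V$ with three finite filtrations $F,\hat F,W$ such that, for every $k\in\mathbb Z$, the filtrations induced by $F$ and $\hat F$ on $Gr_W^kV=W^kV/W^{k+1}V$ form a pure $\mathbb C$-Hodge structure of weight $-k$ (the increasing weight filtration is $W_n=W^{-n}$). A filtration of a complex is a decreasing family of subcomplexes indexed by $\mathbb Z$; it is biregular if it is finite in each degree. A filtration $F$ of a complex $A^\bullet$ induces on cohomology the filtration $F^pH^i(A)=\mathrm{image}[H^i(F^pA)\to H^i(A)]$. It also defines a spectral sequence with differentials $d_r:E_r^{p,q}\to E_r^{p+r,q-r+1}$ and $E_1^{p,q}=H^{p+q}(Gr_F^pA)$; this degenerates at $E_s$ if $d_r=0$ for all $r\ge s$. A $\mathbb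 C$-Hodge complex $(A^\bullet,F,\hat F,W)$ is a bounded below complex $A^\bullet$ (indexed by $\mathbb Z$) of complex vector spaces with three biregular filtrations $F,\hat F,W$ such that: - (HC1) every $H^i(A^\bullet)$ is finite dimensional; - (HC2) for each $p$, the filtrations induced by $F$ and $\hat F$ on $Gr_W^pA$ are strictly preserved by the differentials, i.e. $dF^k=\mathrm{image}(d)\cap F^k$ for all $k$, and likewise for $\hat F$; - (HC3) for all $i,p$, the space $H^i(Gr_W^pA)$, with the filtrations $\mathrm{image}[H^i(F^k Gr_W^pA)\to H^i(Gr_W^pA)]$ and $\mathrm{image}[H^i(\hat F^k Gr_W^pA)\to H^i(Gr_W^pA)]$, is a pure $\mathbb C$-Hodge structure of weight $i-p$. **Theorem.** Let $(A^\bullet,F,\hat F,W)$ be a $\mathbb C$-Hodge complex. Then: (a) The spectral sequence of $(A^\bullet,W)$ degenerates at $E_2$. (b) For every $i$, $H^i(A^\bullet)$ is a $\mathbb C$-mixed Hodge structure with respect to the filtrations $$F^pH^i(A)=\mathrm{image}[H^i(F^pA)\to H^i(A)],\qquad \hat F^pH^i(A)=\mathrm{image}[H^i(\hat F^pA)\to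 H^i(A)],$$ $$W^kH^i(A)=\mathrm{image}[H^i(W^{k+i}A)\to H^i(A)].$$ (c) The spectral sequences of $(A^\bullet,F)$ and of $(A^\bullet,\hat F)$ degenerate at $E_1$. -/

import Mathlib

open CategoryTheory

universe u

namespace CHodge

/-! ### Filtered vector spaces and `ℂ`-Hodge structures -/

section Module

variable {V : Type u} [AddCommGroup V] [Module ℂ V]

/-- A finite decreasing filtration of a vector space by subspaces, indexed by `ℤ`. -/
structure IsFiniteFiltration (F : ℤ → Submodule ℂ V) : Prop where
  antitone : Antitone F
  exhaustive : ∃ a, F a = ⊤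
  separated : ∃ b, F b = ⊥

/-- The graded piece `Gr_W^p V = W^p V / W^{p+1} V`. -/
abbrev Gr (W : ℤ → Submodule ℂ V) (p : ℤ) : Type u :=
  W p ⧸ (W (p + 1)).submoduleOf (W p)

/-- The filtration induced by `F` on the graded piece `Gr_W^p V`:
its `q`-th step is the image of `F^q ∩ W^p`. -/
def grInduced (W F : ℤ → Submodule ℂ V) (p q : ℤ) : Submodule ℂ (Gr W p) :=
  ((F q).submoduleOf (W p)).map ((W (p + 1)).submoduleOf (W p)).mkQ

/-- A pure `ℂ`-Hodge structure of weight `n`: a finite dimensional complex vector space with two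
finite decreasing filtrations that are `n`-opposed, i.e. `V = F^p ⊕ F̂^q` whenever
`p + q = n + 1`. -/
structure IsPureHodge (F Fhat : ℤ → Submodule ℂ V) (n : ℤ) : Prop where
  finiteDimensional : FiniteDimensional ℂ V
  finite_F : IsFiniteFiltration F
  finite_Fhat : IsFiniteFiltration Fhat
  opposed : ∀ p q : ℤ, p + q = n + 1 → IsCompl (F p) (Fhat q)

/-- A `ℂ`-mixed Hodge structure: a finite dimensional complex vector space with three finite
decreasing filtrations `F`, `F̂`, `W` such that `F` and `F̂` induce on
`Gr_W^k V = Gr^W_{-k} V` a pure `ℂ`-Hodge structure of weight `-k`, for all `k`.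
(The increasing weight filtration is `W_n = W^{-n}`.) -/
structure IsMixedHodge (F Fhat W : ℤ → Submodule ℂ V) : Prop where
  finiteDimensional : FiniteDimensional ℂ V
  finite_F : IsFiniteFiltration F
  finite_Fhat : IsFiniteFiltration Fhat
  finite_W : IsFiniteFiltration W
  pure_gr : ∀ k : ℤ, IsPureHodge (grInduced W F k) (grInduced W Fhat k) (-k)

end Module

/-! ### Filtered complexes -/

/-- A decreasing filtration of a complex of complex vector spaces by subcomplexes:
`F n p` is `F^p A^n`. -/
structure Filtration (A : CochainComplex (ModuleCat.{u} ℂ) ℤ) where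
  toFun : (n : ℤ) → ℤ → Submodule ℂ (A.X n)
  antitone' : ∀ n, Antitone (toFun n)
  d_mem' : ∀ p i j, toFun i p ≤ (toFun j p).comap (A.d i j).hom

namespace Filtration

variable {A : CochainComplex (ModuleCat.{u} ℂ) ℤ}

instance : CoeFun (Filtration A) fun _ => (n : ℤ) → ℤ → Submodule ℂ (A.X n) := ⟨toFun⟩

theorem d_mem (F : Filtration A) {p i : ℤ} (j : ℤ) {x : A.X i} (hx : x ∈ F i p) :
    (A.d i j).hom x ∈ F j p :=
  F.d_mem' p i j hx

theorem d_d_apply (i j k : ℤ) (x : A.X i) : (A.d j k).hom ((A.d i j).hom x) = 0 := by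
  rw [← LinearMap.comp_apply, ← ModuleCat.hom_comp, A.d_comp_d]; rfl

/-- A filtration is biregular if in each degree it is finite. -/
def Biregular (F : Filtration A) : Prop :=
  ∀ n, ∃ a b, F n a = ⊤ ∧ F n b = ⊥

/-- The filtration is strictly preserved by the differentials:
`d (F^p A^n) = d (A^n) ∩ F^p A^{n+1}`. -/
def Strict (F : Filtration A) : Prop :=
  ∀ p n, (F n p).map (A.d n (n + 1)).hom =
    LinearMap.range (A.d n (n + 1)).hom ⊓ F (n + 1) p

/-- The subcomplex `F^p A`. -/
def sub (F : Filtration A) (p : ℤ) : CochainComplex (ModuleCat.{u} ℂ) ℤ where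
  X n := ModuleCat.of ℂ (F n p)
  d i j := ModuleCat.ofHom ((A.d i j).hom.restrict fun _ hx => F.d_mem j hx)
  shape i j h := by
    ext x
    simp [A.shape i j h]
  d_comp_d' i j k _ _ := by
    ext x
    exact d_d_apply i j k x.1

/-- The inclusion `F^p A ⟶ A`. -/
def ι (F : Filtration A) (p : ℤ) : F.sub p ⟶ A where
  f n := ModuleCat.ofHom (F n p).subtype
  comm' _ _ _ := rfl

/-- The graded complex `Gr_W^p A = W^p A / W^{p+1} A`. -/
def gr (W : Filtration A) (p : ℤ) : CochainComplex (ModuleCat.{u} ℂ) ℤ where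
  X n := ModuleCat.of ℂ (Gr (W n) p)
  d i j := ModuleCat.ofHom (Submodule.mapQ _ _
    ((A.d i j).hom.restrict fun _ hx => W.d_mem j hx)
    (fun _ hx => W.d_mem (p := p + 1) j hx))
  shape i j h := by
    ext x
    exact (Submodule.Quotient.mk_eq_zero _).2 (by
      simp [A.shape i j h, Submodule.submoduleOf])
  d_comp_d' i j k _ _ := by
    ext x
    exact (Submodule.Quotient.mk_eq_zero _).2
      ((congrArg (· ∈ W k (p + 1)) (d_d_apply i j k x.1)).mpr (zero_mem _))

/-- The filtration induced by `F` on the graded complex `Gr_W^p A`. -/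
def onGr (F W : Filtration A) (p : ℤ) : Filtration (W.gr p) where
  toFun n q := grInduced (W n) (F n) p q
  antitone' n _ _ h := Submodule.map_mono fun x hx => F.antitone' n h hx
  d_mem' q i j := by
    rintro _ ⟨x, hx, rfl⟩
    exact ⟨⟨(A.d i j).hom x.1, W.d_mem j x.2⟩, F.d_mem (p := q) j hx, rfl⟩

/-- The filtration induced on cohomology: `F^p H^i(A) = image [H^i(F^p A) → H^i(A)]`. -/
noncomputable def onHomology (F : Filtration A) (i p : ℤ) : Submodule ℂ (A.homology i) :=
  LinearMap.range (HomologicalComplex.homologyMap (F.ι p) i).hom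

/-! ### The spectral sequence of a filtered complex

The bidegree `(p, q)` is recorded by the pair `(p, n)` with `n = p + q` the total degree, so that
the differential of the `r`-th page goes from `(p, n)` to `(p + r, n + 1)`. -/

/-- `Z_r^{p,n-p} = {x ∈ F^p A^n | dx ∈ F^{p+r} A^{n+1}}`. -/
def Z (F : Filtration A) (r p n : ℤ) : Submodule ℂ (A.X n) :=
  F n p ⊓ (F (n + 1) (p + r)).comap (A.d n (n + 1)).hom

/-- `Z_{r-1}^{p+1,n-p-1} + d Z_{r-1}^{p-r+1,n-p+r-2}`. -/
def B (F : Filtration A) (r p n : ℤ) : Submodule ℂ (A.X n) :=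
  F.Z (r - 1) (p + 1) n ⊔ (F.Z (r - 1) (p - r + 1) (n - 1)).map (A.d (n - 1) n).hom

/-- The term `E_r^{p,n-p}` of the spectral sequence of a filtered complex. -/
abbrev E (F : Filtration A) (r p n : ℤ) : Type u :=
  F.Z r p n ⧸ (F.B r p n).submoduleOf (F.Z r p n)

theorem d_mem_Z (F : Filtration A) (r p n : ℤ) {x : A.X n} (hx : x ∈ F.Z r p n) :
    (A.d n (n + 1)).hom x ∈ F.Z r (p + r) (n + 1) :=
  ⟨hx.2, by
    change (A.d (n + 1) (n + 1 + 1)).hom ((A.d n (n + 1)).hom x) ∈ F (n + 1 + 1) (p + r + r)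
    rw [d_d_apply]
    exact zero_mem _⟩

theorem d_mem_B (F : Filtration A) (r p n : ℤ) {x : A.X n} (hx : x ∈ F.B r p n) :
    (A.d n (n + 1)).hom x ∈ F.B r (p + r) (n + 1) := by
  obtain ⟨y, hy, _, ⟨z, _, rfl⟩, rfl⟩ := Submodule.mem_sup.1 hx
  rw [map_add, d_d_apply, add_zero]
  have key : ∀ m s : ℤ, m = n → s = p + 1 →
      (A.d n (n + 1)).hom y ∈ (F.Z (r - 1) s m).map (A.d m (n + 1)).hom := by
    rintro _ _ rfl rfl
    exact Submodule.mem_map_of_mem hy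
  exact Submodule.mem_sup_right (key _ _ (by ring) (by ring))

/-- The differential `d_r : E_r^{p,q} → E_r^{p+r,q-r+1}`, induced by the differential of the
complex. -/
def dPage (F : Filtration A) (r p n : ℤ) : F.E r p n →ₗ[ℂ] F.E r (p + r) (n + 1) :=
  Submodule.mapQ _ _ ((A.d n (n + 1)).hom.restrict fun _ hx => F.d_mem_Z r p n hx)
    (fun _ hx => F.d_mem_B r p n hx)

/-- The spectral sequence of the filtered complex degenerates at `E_s`: all the differentials
`d_r` with `r ≥ s` vanish. -/
def DegeneratesAt (F : Filtration A) (s : ℤ) : Prop :=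
  ∀ r, s ≤ r → ∀ p n, F.dPage r p n = 0

end Filtration

/-- A `ℂ`-Hodge complex: a bounded below complex of complex vector spaces with three biregular
filtrations `F`, `F̂`, `W`, with finite dimensional cohomology, such that the filtrations induced by
`F` and `F̂` on each `Gr_W^p A` are strictly preserved by the differentials and induce on
`H^i(Gr_W^p A)` a pure `ℂ`-Hodge structure of weight `i - p`. -/
structure HodgeComplex where
  /-- the underlying complex of vector spaces -/
  A : CochainComplex (ModuleCat.{u} ℂ) ℤ
  /-- the filtration `F` -/
  F : Filtration A
  /-- the filtration `F̂` -/
  Fhat : Filtration A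
  /-- the filtration `W` -/
  W : Filtration A
  bounded_below : ∃ N : ℤ, ∀ n < N, Subsingleton (A.X n)
  biregular_F : F.Biregular
  biregular_Fhat : Fhat.Biregular
  biregular_W : W.Biregular
  /-- the cohomology is finite dimensional -/
  finite_homology : ∀ i, FiniteDimensional ℂ (A.homology i)
  /-- the differentials of `Gr_W^p A` are strict for `F` -/
  strict_F : ∀ p, (F.onGr W p).Strict
  /-- the differentials of `Gr_W^p A` are strict for `F̂` -/
  strict_Fhat : ∀ p, (Fhat.onGr W p).Strict
  /-- `H^i(Gr_W^p A)` is pure of weight `i - p` -/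
  pure_gr : ∀ i p, IsPureHodge ((F.onGr W p).onHomology i) ((Fhat.onGr W p).onHomology i) (i - p)

end CHodge

/-! The `E_1` page of the `W`-spectral sequence consists of the pure structures `H^i(Gr_W^p A)` of
weight `i - p`. The differential `d_1` joins structures of equal weight and respects both
filtrations, so it is strict (`exists_sub_d_mem`) and its kernel is again a Hodge structure
(`exists_decomposition_ker`). For `r ≥ 2`, `d_r` lowers the weight by `r - 1`: a class in `F^a ∩
F̂^b` with `a + b` its weight is sent into `F^a ∩ F̂^b` of a structure of smaller weight, which is
zero.

To make sense of `F` and `F̂` on later pages, everything is done on representatives: a class killed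
by `d_1` is lifted inside `F^a` itself. `LiftsTo` (such lifts) and `VanishesAt` (the class of `dx`
is zero on `E_2`) are proved by a joint induction on `r`, in `liftsTo_succ` and `VanishesAt.succ`.
Biregularity of `W` then yields genuine cocycles (`exists_cocycle`).

Subtracting these cocycles shows that `d` is strict for `W` up to a shift by one
(`exists_d_eq_of_mem_W`), which is (a). Pushing a cocycle of `F^a` up the filtration `W` by
boundaries from `F^a` (`exists_mem_F_inf_W`) shows that `d` is strict for `F`, which is (c), and
gives classes in `F^a ∩ W^p` a common representative. With the latter, opposedness on `Gr_W H^i(A)`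
follows from that on `H^i(Gr_W A)` (`isCompl_grInduced`). -/

namespace CHodge

/-! ### Cohomology classes represented by cocycles. -/

section HomologyClass

variable (A : CochainComplex (ModuleCat.{u} ℂ) ℤ)

/-- The cohomology class of a cocycle. -/
noncomputable def homologyClass (i : ℤ) :
    LinearMap.ker (A.d i (i + 1)).hom →ₗ[ℂ] A.homology i :=
  (A.liftCycles (ModuleCat.ofHom (LinearMap.ker (A.d i (i + 1)).hom).subtype) (i + 1) (by simp)
    (by ext x; exact x.2) ≫ A.homologyπ i).hom

variable {A}

theorem homologyClass_iCycles (i : ℤ) (z : A.cycles i)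
    (hz : (A.iCycles i).hom z ∈ LinearMap.ker (A.d i (i + 1)).hom) :
    homologyClass A i ⟨(A.iCycles i).hom z, hz⟩ = (A.homologyπ i).hom z := by
  change (A.homologyπ i).hom ((A.liftCycles _ _ _ _).hom _) = _
  congr 1
  apply (ModuleCat.mono_iff_injective (A.iCycles i)).1 inferInstance
  change (A.liftCycles _ _ _ _ ≫ A.iCycles i).hom _ = _
  rw [HomologicalComplex.liftCycles_i]
  rfl

theorem iCycles_mem_ker (i : ℤ) (z : A.cycles i) :
    (A.iCycles i).hom z ∈ LinearMap.ker (A.d i (i + 1)).hom := by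
  change (A.iCycles i ≫ A.d i (i + 1)).hom z = 0
  rw [HomologicalComplex.iCycles_d]
  rfl

theorem exists_iCycles_eq (i : ℤ) (x : LinearMap.ker (A.d i (i + 1)).hom) :
    ∃ z : A.cycles i, (A.iCycles i).hom z = x.1 := by
  refine ⟨(A.liftCycles (ModuleCat.ofHom (LinearMap.ker (A.d i (i + 1)).hom).subtype) (i + 1)
    (by simp) (by ext x; exact x.2)).hom x, ?_⟩
  change (A.liftCycles _ _ _ _ ≫ A.iCycles i).hom _ = _
  rw [HomologicalComplex.liftCycles_i]
  rfl

theorem homologyClass_surjective (i : ℤ) : Function.Surjective (homologyClass A i) := by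
  intro c
  obtain ⟨z, rfl⟩ := (ModuleCat.epi_iff_surjective (A.homologyπ i)).1 inferInstance c
  exact ⟨_, homologyClass_iCycles i z (iCycles_mem_ker i z)⟩

theorem homologyClass_eq_zero_iff {j i : ℤ} (hij : j + 1 = i)
    (x : LinearMap.ker (A.d i (i + 1)).hom) :
    homologyClass A i x = 0 ↔ ∃ y : A.X j, (A.d j i).hom y = x.1 := by
  obtain ⟨z, hz⟩ := exists_iCycles_eq i x
  obtain rfl : x = ⟨_, iCycles_mem_ker i z⟩ := Subtype.ext hz.symm
  rw [homologyClass_iCycles]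
  have hexact : (ShortComplex.mk _ _ (A.toCycles_comp_homologyπ j i)).Exact :=
    ShortComplex.exact_of_g_is_cokernel _
      (A.homologyIsCokernel j i (by simp; omega))
  constructor
  · intro h
    obtain ⟨y, hy⟩ := (ShortComplex.moduleCat_exact_iff _).1 hexact z h
    refine ⟨y, ?_⟩
    rw [← A.toCycles_i j i]
    exact congrArg (A.iCycles i).hom hy
  · rintro ⟨y, hy⟩
    have : (A.toCycles j i).hom y = z := by
      apply (ModuleCat.mono_iff_injective (A.iCycles i)).1 inferInstance
      change (A.toCycles j i ≫ A.iCycles i).hom y = _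
      rw [A.toCycles_i]
      exact hy
    rw [← this]
    change (A.toCycles j i ≫ A.homologyπ i).hom y = 0
    rw [A.toCycles_comp_homologyπ]
    rfl

theorem homologyMap_homologyClass {A' : CochainComplex (ModuleCat.{u} ℂ) ℤ} (f : A ⟶ A') (i : ℤ)
    (x : LinearMap.ker (A.d i (i + 1)).hom)
    (hx : (f.f i).hom x.1 ∈ LinearMap.ker (A'.d i (i + 1)).hom) :
    (HomologicalComplex.homologyMap f i).hom (homologyClass A i x) =
      homologyClass A' i ⟨(f.f i).hom x.1, hx⟩ := by
  obtain ⟨z, hz⟩ := exists_iCycles_eq i x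
  obtain rfl : x = ⟨_, iCycles_mem_ker i z⟩ := Subtype.ext hz.symm
  have h : (f.f i).hom ((A.iCycles i).hom z) =
      (A'.iCycles i).hom ((HomologicalComplex.cyclesMap f i).hom z) := by
    change (A.iCycles i ≫ f.f i).hom z = (HomologicalComplex.cyclesMap f i ≫ A'.iCycles i).hom z
    rw [HomologicalComplex.cyclesMap_i]
  rw [homologyClass_iCycles]
  simp only [h]
  rw [homologyClass_iCycles]
  change (A.homologyπ i ≫ HomologicalComplex.homologyMap f i).hom z =
    (HomologicalComplex.cyclesMap f i ≫ A'.homologyπ i).hom z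
  rw [HomologicalComplex.homologyπ_naturality]

/-- Removes the cohomology of the subcomplexes `F^p A` from all later arguments, which only handle
cocycles of `A`. -/
theorem Filtration.mem_onHomology (F : Filtration A) (i p : ℤ) (c : A.homology i) :
    c ∈ F.onHomology i p ↔
      ∃ x : LinearMap.ker (A.d i (i + 1)).hom, x.1 ∈ F i p ∧ homologyClass A i x = c := by
  constructor
  · rintro ⟨c', rfl⟩
    obtain ⟨x, rfl⟩ := homologyClass_surjective i c'
    have hx : (A.d i (i + 1)).hom (x.1 : F i p).1 = 0 := congrArg Subtype.val x.2
    exact ⟨⟨(x.1 : F i p).1, hx⟩, (x.1 : F i p).2,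
      (homologyMap_homologyClass (F.ι p) i x hx).symm⟩
  · rintro ⟨x, hx, rfl⟩
    exact ⟨homologyClass (F.sub p) i ⟨⟨x.1, hx⟩, Subtype.ext x.2⟩,
      homologyMap_homologyClass (F.ι p) i ⟨⟨x.1, hx⟩, Subtype.ext x.2⟩ x.2⟩

theorem Filtration.onHomology_finite {F : Filtration A} (hF : F.Biregular) (i : ℤ) :
    IsFiniteFiltration (F.onHomology i) := by
  obtain ⟨a, b, ha, hb⟩ := hF i
  refine ⟨fun p q h c hc => ?_, ⟨a, eq_top_iff.2 fun c _ => ?_⟩, ⟨b, eq_bot_iff.2 fun c hc => ?_⟩⟩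
  · obtain ⟨x, hx, rfl⟩ := (F.mem_onHomology i q c).1 hc
    exact (F.mem_onHomology i p _).2 ⟨x, F.antitone' i h hx, rfl⟩
  · obtain ⟨x, rfl⟩ := homologyClass_surjective i c
    exact (F.mem_onHomology i a _).2 ⟨x, ha ▸ Submodule.mem_top, rfl⟩
  · obtain ⟨x, hx, rfl⟩ := (F.mem_onHomology i b c).1 hc
    obtain rfl : x = 0 := Subtype.ext (by simpa [hb] using hx)
    simp

end HomologyClass

/-! ### Finite filtrations, and the symmetry between `F` and `F̂`. -/

section Module

variable {V : Type u} [AddCommGroup V] [Module ℂ V]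

theorem IsFiniteFiltration.shift {F : ℤ → Submodule ℂ V} (hF : IsFiniteFiltration F) (i : ℤ) :
    IsFiniteFiltration fun k => F (k + i) := by
  obtain ⟨a, ha⟩ := hF.exhaustive
  obtain ⟨b, hb⟩ := hF.separated
  exact ⟨fun p q h => hF.antitone (by omega), ⟨a - i, by simpa using ha⟩,
    ⟨b - i, by simpa using hb⟩⟩

theorem IsFiniteFiltration.grInduced {F : ℤ → Submodule ℂ V} (hF : IsFiniteFiltration F)
    (W : ℤ → Submodule ℂ V) (p : ℤ) : IsFiniteFiltration (grInduced W F p) := by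
  obtain ⟨a, ha⟩ := hF.exhaustive
  obtain ⟨b, hb⟩ := hF.separated
  refine ⟨fun q r h => Submodule.map_mono fun x hx => hF.antitone h hx,
    ⟨a, eq_top_iff.2 fun z _ => ?_⟩, ⟨b, eq_bot_iff.2 ?_⟩⟩
  · obtain ⟨x, rfl⟩ := Submodule.mkQ_surjective _ z
    exact ⟨x, show x.1 ∈ F a from ha ▸ Submodule.mem_top, rfl⟩
  · rintro _ ⟨x, hx, rfl⟩
    have hx0 : x.1 ∈ F b := hx
    obtain rfl : x = 0 := Subtype.ext (by simpa [hb] using hx0)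
    exact map_zero _

theorem IsPureHodge.symm {F Fhat : ℤ → Submodule ℂ V} {n : ℤ} (h : IsPureHodge F Fhat n) :
    IsPureHodge Fhat F n :=
  ⟨h.finiteDimensional, h.finite_Fhat, h.finite_F,
    fun p q hpq => (h.opposed q p (by omega)).symm⟩

end Module

/-- The Hodge complex with the roles of `F` and `F̂` exchanged. -/
def HodgeComplex.swap (K : HodgeComplex.{u}) : HodgeComplex.{u} where
  A := K.A
  F := K.Fhat
  Fhat := K.F
  W := K.W
  bounded_below := K.bounded_below
  biregular_F := K.biregular_Fhat
  biregular_Fhat := K.biregular_F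
  biregular_W := K.biregular_W
  finite_homology := K.finite_homology
  strict_F := K.strict_Fhat
  strict_Fhat := K.strict_F
  pure_gr i p := (K.pure_gr i p).symm

/-! ### Representatives for the graded complexes. -/

namespace Filtration

variable {A : CochainComplex (ModuleCat.{u} ℂ) ℤ}

theorem mem_of_le (F : Filtration A) {i p q : ℤ} (h : q ≤ p) {x : A.X i} (hx : x ∈ F i p) :
    x ∈ F i q :=
  F.antitone' i h hx

theorem exists_le_mem {F : Filtration A} (hF : F.Biregular) (i : ℤ) : ∃ a, ∀ x : A.X i, x ∈ F i a :=
  let ⟨a, _, ha, _⟩ := hF i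
  ⟨a, fun _ => ha ▸ Submodule.mem_top⟩

theorem exists_mem_eq_zero {F : Filtration A} (hF : F.Biregular) (i : ℤ) :
    ∃ b, ∀ c, b ≤ c → ∀ x ∈ F i c, x = 0 :=
  let ⟨_, b, _, hb⟩ := hF i
  ⟨b, fun _ hc x hx => by simpa [hb] using F.mem_of_le hc hx⟩

/-- The image in `Gr_W^p A` of an element of `W^p A`. -/
def grMk (W : Filtration A) (p i : ℤ) {x : A.X i} (hx : x ∈ W i p) : (W.gr p).X i :=
  ((W i (p + 1)).submoduleOf (W i p)).mkQ ⟨x, hx⟩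

theorem grMk_eq_iff (W : Filtration A) {p i : ℤ} {x y : A.X i} (hx : x ∈ W i p) (hy : y ∈ W i p) :
    W.grMk p i hx = W.grMk p i hy ↔ x - y ∈ W i (p + 1) :=
  Submodule.Quotient.eq ((W i (p + 1)).submoduleOf (W i p))

theorem grMk_eq_zero_iff (W : Filtration A) {p i : ℤ} {x : A.X i} (hx : x ∈ W i p) :
    W.grMk p i hx = 0 ↔ x ∈ W i (p + 1) :=
  Submodule.Quotient.mk_eq_zero ((W i (p + 1)).submoduleOf (W i p))

theorem exists_grMk_eq (W : Filtration A) (p i : ℤ) (z : (W.gr p).X i) :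
    ∃ (x : A.X i) (hx : x ∈ W i p), W.grMk p i hx = z :=
  let ⟨⟨x, hx⟩, h⟩ := Submodule.mkQ_surjective _ z
  ⟨x, hx, h⟩

/-- The image in `Gr_W^p A` of an element of `W^p A`, as a cocycle. -/
def grCocycle (W : Filtration A) (p i : ℤ) {x : A.X i} (hx : x ∈ W i p)
    (hdx : (A.d i (i + 1)).hom x ∈ W (i + 1) (p + 1)) :
    LinearMap.ker ((W.gr p).d i (i + 1)).hom :=
  ⟨W.grMk p i hx, (W.grMk_eq_zero_iff (W.d_mem _ hx)).2 hdx⟩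

theorem homologyClass_grCocycle_eq_zero_iff (W : Filtration A) (p : ℤ) {j i : ℤ} (hij : j + 1 = i)
    {x : A.X i} (hx : x ∈ W i p) (hdx : (A.d i (i + 1)).hom x ∈ W (i + 1) (p + 1)) :
    homologyClass (W.gr p) i (W.grCocycle p i hx hdx) = 0 ↔
      ∃ y ∈ W j p, x - (A.d j i).hom y ∈ W i (p + 1) := by
  rw [homologyClass_eq_zero_iff hij]
  constructor
  · rintro ⟨z, hz⟩
    obtain ⟨y, hy, rfl⟩ := W.exists_grMk_eq p j z
    exact ⟨y, hy, (W.grMk_eq_iff hx (W.d_mem i hy)).1 hz.symm⟩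
  · rintro ⟨y, hy, h⟩
    exact ⟨W.grMk p j hy, ((W.grMk_eq_iff hx (W.d_mem i hy)).2 h).symm⟩

theorem mem_onGr_onHomology (F W : Filtration A) (p i k : ℤ) (c : (W.gr p).homology i) :
    c ∈ (F.onGr W p).onHomology i k ↔
      ∃ (x : A.X i) (hx : x ∈ W i p) (hdx : (A.d i (i + 1)).hom x ∈ W (i + 1) (p + 1)),
        x ∈ F i k ∧ homologyClass (W.gr p) i (W.grCocycle p i hx hdx) = c := by
  rw [mem_onHomology]
  constructor
  · rintro ⟨⟨_, hz⟩, ⟨⟨x, hx⟩, hxF, rfl⟩, rfl⟩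
    exact ⟨x, hx, (W.grMk_eq_zero_iff (W.d_mem _ hx)).1 hz, hxF, rfl⟩
  · rintro ⟨x, hx, hdx, hxF, rfl⟩
    exact ⟨_, ⟨⟨x, hx⟩, hxF, rfl⟩, rfl⟩

end Filtration

/-! ### The Hodge conditions on representatives. -/

namespace HodgeComplex

variable (K : HodgeComplex.{u})

/-- Strictness of `F` on `Gr_W^p A`, in terms of representatives. -/
theorem exists_strict {p k i j : ℤ} (hij : i + 1 = j) {x : K.A.X i} {y : K.A.X j}
    (hx : x ∈ K.W i p) (hyF : y ∈ K.F j k) (hyW : y ∈ K.W j p)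
    (h : y - (K.A.d i j).hom x ∈ K.W j (p + 1)) :
    ∃ x' ∈ K.F i k, x' ∈ K.W i p ∧ y - (K.A.d i j).hom x' ∈ K.W j (p + 1) := by
  subst hij
  have hle := (K.strict_F p k i).ge
  have hmem : K.W.grMk p (i + 1) hyW ∈
      LinearMap.range ((K.W.gr p).d i (i + 1)).hom ⊓ (K.F.onGr K.W p) (i + 1) k :=
    ⟨⟨K.W.grMk p i hx, ((K.W.grMk_eq_iff hyW (K.W.d_mem _ hx)).2 h).symm⟩, ⟨⟨y, hyW⟩, hyF, rfl⟩⟩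
  obtain ⟨_, ⟨⟨x', hx'⟩, hx'F, rfl⟩, he⟩ := hle hmem
  exact ⟨x', hx'F, hx', (K.W.grMk_eq_iff hyW (K.W.d_mem _ hx')).1 he.symm⟩

/-- `H^i(Gr_W^p A) = F^a + F̂^b` for `a + b = i - p + 1`, in terms of representatives. -/
theorem exists_decomposition {p i j a b : ℤ} (hji : j + 1 = i) (hab : a + b = i - p + 1)
    {x : K.A.X i} (hx : x ∈ K.W i p) (hdx : (K.A.d i (i + 1)).hom x ∈ K.W (i + 1) (p + 1)) :
    ∃ x₁ x₂ y, x₁ ∈ K.F i a ∧ x₁ ∈ K.W i p ∧ (K.A.d i (i + 1)).hom x₁ ∈ K.W (i + 1) (p + 1) ∧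
      x₂ ∈ K.Fhat i b ∧ x₂ ∈ K.W i p ∧ (K.A.d i (i + 1)).hom x₂ ∈ K.W (i + 1) (p + 1) ∧
      y ∈ K.W j p ∧ x - x₁ - x₂ - (K.A.d j i).hom y ∈ K.W i (p + 1) := by
  have htop := ((K.pure_gr i p).opposed a b hab).sup_eq_top.ge
    (Submodule.mem_top (x := homologyClass (K.W.gr p) i (K.W.grCocycle p i hx hdx)))
  obtain ⟨c₁, h₁, c₂, h₂, h⟩ := Submodule.mem_sup.1 htop
  obtain ⟨x₁, hW₁, hd₁, hF₁, rfl⟩ := (Filtration.mem_onGr_onHomology _ _ _ _ _ _).1 h₁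
  obtain ⟨x₂, hW₂, hd₂, hF₂, rfl⟩ := (Filtration.mem_onGr_onHomology _ _ _ _ _ _).1 h₂
  have hW : x - x₁ - x₂ ∈ K.W i p := sub_mem (sub_mem hx hW₁) hW₂
  have hd : (K.A.d i (i + 1)).hom (x - x₁ - x₂) ∈ K.W (i + 1) (p + 1) := by
    rw [map_sub, map_sub]
    exact sub_mem (sub_mem hdx hd₁) hd₂
  have h0 : homologyClass (K.W.gr p) i (K.W.grCocycle p i hW hd) = 0 := by
    have : K.W.grCocycle p i hW hd =
        K.W.grCocycle p i hx hdx - K.W.grCocycle p i hW₁ hd₁ - K.W.grCocycle p i hW₂ hd₂ := rfl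
    rw [this, map_sub, map_sub, ← h]
    abel
  obtain ⟨y, hy, hxy⟩ := (K.W.homologyClass_grCocycle_eq_zero_iff p hji hW hd).1 h0
  exact ⟨x₁, x₂, y, hF₁, hW₁, hd₁, hF₂, hW₂, hd₂, hy, hxy⟩

/-- `F^a ∩ F̂^b = 0` in `H^i(Gr_W^p A)` for `a + b > i - p`, in terms of representatives. -/
theorem exists_boundary_of_opposed {p i j a b : ℤ} (hji : j + 1 = i) (hab : a + b = i - p + 1)
    {x₁ x₂ : K.A.X i} {y : K.A.X j} (hF₁ : x₁ ∈ K.F i a) (hW₁ : x₁ ∈ K.W i p)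
    (hd₁ : (K.A.d i (i + 1)).hom x₁ ∈ K.W (i + 1) (p + 1))
    (hF₂ : x₂ ∈ K.Fhat i b) (hW₂ : x₂ ∈ K.W i p)
    (hd₂ : (K.A.d i (i + 1)).hom x₂ ∈ K.W (i + 1) (p + 1))
    (hy : y ∈ K.W j p) (h : x₁ - x₂ - (K.A.d j i).hom y ∈ K.W i (p + 1)) :
    ∃ z ∈ K.F j a, z ∈ K.W j p ∧ x₁ - (K.A.d j i).hom z ∈ K.W i (p + 1) := by
  have hW : x₁ - x₂ ∈ K.W i p := sub_mem hW₁ hW₂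
  have hd : (K.A.d i (i + 1)).hom (x₁ - x₂) ∈ K.W (i + 1) (p + 1) := by
    rw [map_sub]
    exact sub_mem hd₁ hd₂
  have h0 := (K.W.homologyClass_grCocycle_eq_zero_iff p hji hW hd).2 ⟨y, hy, h⟩
  have heq : homologyClass (K.W.gr p) i (K.W.grCocycle p i hW₁ hd₁) =
      homologyClass (K.W.gr p) i (K.W.grCocycle p i hW₂ hd₂) := by
    have : K.W.grCocycle p i hW hd =
        K.W.grCocycle p i hW₁ hd₁ - K.W.grCocycle p i hW₂ hd₂ := rfl
    rwa [this, map_sub, sub_eq_zero] at h0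
  have hbot := ((K.pure_gr i p).opposed a b hab).inf_eq_bot.le
    (Submodule.mem_inf.2
      ⟨(Filtration.mem_onGr_onHomology K.F K.W p i a _).2 ⟨x₁, hW₁, hd₁, hF₁, rfl⟩,
        (Filtration.mem_onGr_onHomology K.Fhat K.W p i b _).2 ⟨x₂, hW₂, hd₂, hF₂, heq.symm⟩⟩)
  obtain ⟨z, hz, hxz⟩ := (K.W.homologyClass_grCocycle_eq_zero_iff p hji hW₁ hd₁).1
    ((Submodule.mem_bot ℂ).1 hbot)
  -- The zero class bounds some `z` with no control on `F`; strictness on `Gr_W^p A` replaces it by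
  -- one in `F^a`.
  exact K.exists_strict hji hz hF₁ hW₁ hxz

theorem exists_boundary_of_opposed_Fhat {p i j a b : ℤ} (hji : j + 1 = i) (hab : a + b = i - p + 1)
    {x₁ x₂ : K.A.X i} {y : K.A.X j} (hF₁ : x₁ ∈ K.Fhat i b) (hW₁ : x₁ ∈ K.W i p)
    (hd₁ : (K.A.d i (i + 1)).hom x₁ ∈ K.W (i + 1) (p + 1))
    (hF₂ : x₂ ∈ K.F i a) (hW₂ : x₂ ∈ K.W i p)
    (hd₂ : (K.A.d i (i + 1)).hom x₂ ∈ K.W (i + 1) (p + 1))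
    (hy : y ∈ K.W j p) (h : x₁ - x₂ - (K.A.d j i).hom y ∈ K.W i (p + 1)) :
    ∃ z ∈ K.Fhat j b, z ∈ K.W j p ∧ x₁ - (K.A.d j i).hom z ∈ K.W i (p + 1) :=
  K.swap.exists_boundary_of_opposed hji ((add_comm b a).trans hab) hF₁ hW₁ hd₁ hF₂ hW₂ hd₂ hy h

end HodgeComplex

/-! ### Strictness of `d_1`. -/

namespace HodgeComplex

variable (K : HodgeComplex.{u})

open Filtration

/-- Suppose that `α ∈ F^a` and `β ∈ F̂^b` are representatives of classes on the `E_1` page whose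
difference is in the image of `d_1`, with `a + b` larger than the weight. Then the class of `α` is
the image under `d_1` of a class in `F^a`. -/
theorem exists_sub_d_mem {q j i a b : ℤ} (hji : j + 1 = i) (hab : i - q + 1 ≤ a + b)
    {α β : K.A.X i} {y : K.A.X j} (hαF : α ∈ K.F i a) (hαW : α ∈ K.W i q)
    (hdα : (K.A.d i (i + 1)).hom α ∈ K.W (i + 1) (q + 1))
    (hβF : β ∈ K.Fhat i b) (hβW : β ∈ K.W i q)
    (hdβ : (K.A.d i (i + 1)).hom β ∈ K.W (i + 1) (q + 1))
    (hy : y ∈ K.W j (q - 1)) (h : α - β - (K.A.d j i).hom y ∈ K.W i (q + 1)) :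
    ∃ v ∈ K.F j a, v ∈ K.W j (q - 1) ∧ α - (K.A.d j i).hom v ∈ K.W i (q + 1) := by
  subst hji
  have hdy : (K.A.d j (j + 1)).hom y ∈ K.W (j + 1) (q - 1 + 1) := by
    have := sub_mem (sub_mem hαW hβW) (K.W.mem_of_le (by omega : q ≤ q + 1) h)
    rw [sub_sub_cancel] at this
    exact K.W.mem_of_le (by omega) this
  -- Source and target of `d_1` both have weight `j - (q - 1)`; the second index, weight `+ 1 - a`,
  -- is at most `b`.
  obtain ⟨y₁, y₂, t, hF₁, hW₁, hd₁, hF₂, hW₂, hd₂, -, hw⟩ :=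
    K.exists_decomposition (a := a) (b := j - (q - 1) + 1 - a) (sub_add_cancel j 1) (by ring) hy hdy
  rw [sub_add_cancel] at hd₁ hd₂ hw
  -- Moving `dy₁` to `α` and `dy₂` to `β` leaves a difference that is, modulo `W^{q+1}`, the
  -- differential of the remainder in `W^q`; opposedness in the target applies.
  obtain ⟨z, hzF, hzW, hz⟩ := K.exists_boundary_of_opposed (p := q) (a := a)
    (b := j - (q - 1) + 1 - a) (x₁ := α - (K.A.d j (j + 1)).hom y₁)
    (x₂ := β + (K.A.d j (j + 1)).hom y₂) rfl (by ring)
    (sub_mem hαF (K.F.d_mem _ hF₁)) (sub_mem hαW hd₁) (by simpa [d_d_apply] using hdα)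
    (add_mem (K.Fhat.mem_of_le (by omega) hβF) (K.Fhat.d_mem _ hF₂)) (add_mem hβW hd₂)
    (by simpa [d_d_apply] using hdβ) hw (by
      convert h using 1
      simp only [map_sub, d_d_apply]
      abel)
  refine ⟨y₁ + z, add_mem hF₁ hzF, add_mem hW₁ (K.W.mem_of_le (by omega) hzW), ?_⟩
  rwa [map_add, ← sub_sub]

/-- `H^i(Gr_W^p A) = F^a + F̂^b` for `a + b = i - p + 1`, within the kernel of `d_1`. -/
theorem exists_decomposition_ker {p i j a b : ℤ} (hji : j + 1 = i) (hab : a + b = i - p + 1)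
    {x : K.A.X i} (hx : x ∈ K.W i p) (hdx : (K.A.d i (i + 1)).hom x ∈ K.W (i + 1) (p + 2)) :
    ∃ x₁ x₂ y, x₁ ∈ K.F i a ∧ x₁ ∈ K.W i p ∧ (K.A.d i (i + 1)).hom x₁ ∈ K.W (i + 1) (p + 2) ∧
      x₂ ∈ K.Fhat i b ∧ x₂ ∈ K.W i p ∧ (K.A.d i (i + 1)).hom x₂ ∈ K.W (i + 1) (p + 2) ∧
      y ∈ K.W j p ∧ x - x₁ - x₂ - (K.A.d j i).hom y ∈ K.W i (p + 1) := by
  obtain ⟨x₁, x₂, y, hF₁, hW₁, hd₁, hF₂, hW₂, hd₂, hy, hw⟩ :=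
    K.exists_decomposition hji hab hx (K.W.mem_of_le (by omega) hdx)
  have hdw : (K.A.d i (i + 1)).hom (x - x₁ - x₂ - (K.A.d j i).hom y) =
      (K.A.d i (i + 1)).hom x - (K.A.d i (i + 1)).hom x₁ - (K.A.d i (i + 1)).hom x₂ := by
    simp only [map_sub, d_d_apply, sub_zero]
  have hp : p + 1 + 1 = p + 2 := by ring
  -- On `E_1`, `d_1 x₁ = -d_1 x₂` lies in `F^a ∩ F̂^b`, zero because `a + b` exceeds the target
  -- weight `i - p`. The corrections `z₁`, `z₂` lie in `W^{p+1}`, so they do not change the classes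
  -- of `x₁`, `x₂`.
  obtain ⟨z₁, hzF₁, hzW₁, hz₁⟩ := K.exists_boundary_of_opposed (p := p + 1)
    (x₁ := (K.A.d i (i + 1)).hom x₁) (x₂ := -(K.A.d i (i + 1)).hom x₂)
    (y := -(x - x₁ - x₂ - (K.A.d j i).hom y)) rfl (by omega)
    (K.F.d_mem _ hF₁) hd₁ (by rw [d_d_apply]; exact zero_mem _)
    (neg_mem (K.Fhat.d_mem _ hF₂)) (neg_mem hd₂)
    (by rw [map_neg, d_d_apply, neg_zero]; exact zero_mem _)
    (neg_mem hw) (by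
      rw [map_neg, hdw, hp]
      convert hdx using 1
      abel)
  obtain ⟨z₂, hzF₂, hzW₂, hz₂⟩ := K.exists_boundary_of_opposed_Fhat (p := p + 1)
    (x₁ := (K.A.d i (i + 1)).hom x₂) (x₂ := -(K.A.d i (i + 1)).hom x₁)
    (y := -(x - x₁ - x₂ - (K.A.d j i).hom y)) rfl (by omega)
    (K.Fhat.d_mem _ hF₂) hd₂ (by rw [d_d_apply]; exact zero_mem _)
    (neg_mem (K.F.d_mem _ hF₁)) (neg_mem hd₁)
    (by rw [map_neg, d_d_apply, neg_zero]; exact zero_mem _)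
    (neg_mem hw) (by
      rw [map_neg, hdw, hp]
      convert hdx using 1
      abel)
  rw [← map_sub, hp] at hz₁ hz₂
  refine ⟨x₁ - z₁, x₂ - z₂, y, sub_mem hF₁ hzF₁, sub_mem hW₁ (K.W.mem_of_le (by omega) hzW₁), hz₁,
    sub_mem hF₂ hzF₂, sub_mem hW₂ (K.W.mem_of_le (by omega) hzW₂), hz₂, hy, ?_⟩
  convert add_mem hw (add_mem hzW₁ hzW₂) using 1
  abel

end HodgeComplex

/-! ### Lifting to higher pages and vanishing of the differentials. -/

namespace Filtration

variable {A : CochainComplex (ModuleCat.{u} ℂ) ℤ}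

/-- Every element of `F^a ∩ W^p` whose class on the `E_1` page of `W` is killed by `d_1` can be
modified within `F^a` and modulo `W^{p+1}` so that its differential is in `W^{p+r}`. -/
def LiftsTo (F W : Filtration A) (r : ℤ) : Prop :=
  ∀ (p i a : ℤ) (x : A.X i), x ∈ F i a → x ∈ W i p →
    (A.d i (i + 1)).hom x ∈ W (i + 1) (p + 2) →
      ∃ x' ∈ F i a, x' ∈ W i p ∧ x - x' ∈ W i (p + 1) ∧
        (A.d i (i + 1)).hom x' ∈ W (i + 1) (p + r)

/-- If `x ∈ W^p` and `dx ∈ W^{p+r}`, then `dx` is modulo `W^{p+r+1}` the differential of an element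
of `W^{p+r-1}`. -/
def VanishesAt (W : Filtration A) (r : ℤ) : Prop :=
  ∀ (p i : ℤ) (x : A.X i), x ∈ W i p → (A.d i (i + 1)).hom x ∈ W (i + 1) (p + r) →
    ∃ u ∈ W i (p + r - 1),
      (A.d i (i + 1)).hom x - (A.d i (i + 1)).hom u ∈ W (i + 1) (p + r + 1)

/-- A lift `x'` of `x` has differential in `W^{p+r+1}`, so only `x - x'` matters; it lies one step
deeper in `W`, where vanishing for `r - 1` applies. -/
theorem VanishesAt.succ {F W : Filtration A} (hF : F.Biregular) {r : ℤ} (hr : 2 ≤ r)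
    (hL : F.LiftsTo W (r + 1)) (hV : W.VanishesAt (r - 1)) : W.VanishesAt r := by
  intro p i x hx hdx
  obtain ⟨a, ha⟩ := exists_le_mem hF i
  obtain ⟨x', -, -, hxx', hdx'⟩ := hL p i a x (ha x) hx (W.mem_of_le (by omega) hdx)
  obtain ⟨u, hu, hdu⟩ := hV (p + 1) i (x - x') hxx' (by
    rw [map_sub]
    exact sub_mem (W.mem_of_le (by omega) hdx) (W.mem_of_le (by omega) hdx'))
  refine ⟨u, W.mem_of_le (by omega) hu, ?_⟩
  have := add_mem (W.mem_of_le (by omega : p + r + 1 ≤ _) hdu)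
    (W.mem_of_le (by omega : p + r + 1 ≤ _) hdx')
  convert this using 1
  rw [map_sub]
  abel

/-- Here `u` lies in `Z_{r-1}^{p+1}`, whose image under `d` is part of the denominator of the
target. Taking `s = p + r` for `F` and `s = p + r - 1` for `W` makes `p + 1 ≤ s` read `r ≥ 1` and `r
≥ 2`: hence `E_1` and `E_2`. -/
theorem dPage_eq_zero (F : Filtration A) {r p n s : ℤ} (hs : p + 1 ≤ s)
    (h : ∀ x ∈ F.Z r p n, ∃ u ∈ F n s, (A.d n (n + 1)).hom u = (A.d n (n + 1)).hom x) :
    F.dPage r p n = 0 := by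
  refine LinearMap.ext fun z => ?_
  obtain ⟨⟨x, hx⟩, rfl⟩ := Submodule.mkQ_surjective _ z
  obtain ⟨u, hu, h⟩ := h x hx
  refine (Submodule.Quotient.mk_eq_zero _).2 ?_
  change (A.d n (n + 1)).hom x ∈ F.B r (p + r) (n + 1)
  have key : ∀ m t : ℤ, m = n → t = p + 1 →
      (A.d n (n + 1)).hom x ∈ (F.Z (r - 1) t m).map (A.d m (n + 1)).hom := by
    rintro m t rfl rfl
    refine ⟨u, ⟨F.mem_of_le hs hu, ?_⟩, h⟩
    change (A.d m (m + 1)).hom u ∈ F (m + 1) (p + 1 + (r - 1))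
    rw [h]
    exact F.mem_of_le (by omega) hx.2
  exact Submodule.mem_sup_right (key _ _ (by ring) (by ring))

end Filtration

namespace HodgeComplex

open Filtration

variable {K : HodgeComplex.{u}}

theorem liftsTo_succ {r : ℤ} (hr : 2 ≤ r) (hL : K.F.LiftsTo K.W r) (hL' : K.Fhat.LiftsTo K.W r)
    (hV : K.W.VanishesAt (r - 1)) : K.F.LiftsTo K.W (r + 1) := by
  intro p i
  obtain ⟨c, hc⟩ := exists_mem_eq_zero K.biregular_F i
  -- Descending induction on `a`, starting where `F^a A^i = 0`.
  suffices H : ∀ (m : ℕ) (a : ℤ), c - m ≤ a → ∀ x : K.A.X i, x ∈ K.F i a → x ∈ K.W i p →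
      (K.A.d i (i + 1)).hom x ∈ K.W (i + 1) (p + 2) →
      ∃ x' ∈ K.F i a, x' ∈ K.W i p ∧ x - x' ∈ K.W i (p + 1) ∧
        (K.A.d i (i + 1)).hom x' ∈ K.W (i + 1) (p + (r + 1)) by
    intro a x
    exact H (c - a).toNat a (by omega) x
  intro m
  induction m with
  | zero =>
    intro a ha x hx _ _
    obtain rfl := hc a (by simpa using ha) x hx
    exact ⟨0, zero_mem _, zero_mem _, by simp, by simp⟩
  | succ m ih =>
    intro a ha x hxF hxW hdx
    -- decompose the class of `x` along `F^{a+1} + F̂^b` with `a + b` equal to the weight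
    obtain ⟨x₁, x₂, y, hF₁, hW₁, hd₁, hF₂, hW₂, hd₂, hy, hw⟩ :=
      K.exists_decomposition_ker (a := a + 1) (b := i - p - a) (sub_add_cancel i 1) (by ring) hxW
        hdx
    -- lift the component in `F^{a+1}`
    obtain ⟨s, hsF, hsW, hs, hds⟩ := ih (a + 1) (by push_cast at ha; omega) x₁ hF₁ hW₁ hd₁
    -- lift the component in `F^a ∩ F̂^b`
    obtain ⟨α, hαF, hαW, hα, hdα⟩ := hL p i a (x - x₁)
      (sub_mem hxF (K.F.mem_of_le (by omega) hF₁)) (sub_mem hxW hW₁)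
      (by rw [map_sub]; exact sub_mem hdx hd₁)
    obtain ⟨β, hβF, hβW, hβ, hdβ⟩ := hL' p i (i - p - a) x₂ hF₂ hW₂ hd₂
    have hw' : α - β - (K.A.d (i - 1) i).hom y ∈ K.W i (p + 1) := by
      have := add_mem (sub_mem hβ hα) hw
      convert this using 1
      abel
    have hdw' : (K.A.d i (i + 1)).hom (α - β - (K.A.d (i - 1) i).hom y) =
        (K.A.d i (i + 1)).hom α - (K.A.d i (i + 1)).hom β := by
      rw [map_sub, map_sub, d_d_apply, sub_zero]
    -- `α` and `β` have the same class on `E_1`, so `dα - dβ` is the differential of an element of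
    -- `W^{p+1}`, which the earlier vanishing controls.
    obtain ⟨u, hu, hdu⟩ := hV (p + 1) i _ hw' (by
      rw [hdw', show p + 1 + (r - 1) = p + r by ring]
      exact sub_mem hdα hdβ)
    rw [hdw'] at hdu
    -- The weights decide: `a + b = i - p` exceeds the target weight `i + 1 - (p + r)` exactly
    -- because `r ≥ 2`.
    obtain ⟨v, hvF, hvW, hv⟩ := K.exists_sub_d_mem (q := p + r) (a := a) (b := i - p - a) rfl
      (by omega) (K.F.d_mem _ hαF) hdα (by rw [d_d_apply]; exact zero_mem _)
      (K.Fhat.d_mem _ hβF) hdβ (by rw [d_d_apply]; exact zero_mem _)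
      (K.W.mem_of_le (by omega) hu) (K.W.mem_of_le (by omega) hdu)
    have hvW' : v ∈ K.W i (p + 1) := K.W.mem_of_le (by omega) hvW
    refine ⟨s + (α - v), add_mem (K.F.mem_of_le (by omega) hsF) (sub_mem hαF hvF),
      add_mem hsW (sub_mem hαW (K.W.mem_of_le (by omega) hvW')), ?_, ?_⟩
    · convert add_mem (add_mem hs hα) hvW' using 1
      abel
    · rw [map_add, map_sub]
      exact add_mem hds (K.W.mem_of_le (by omega) hv)

variable (K)

/-- Lifting for one filtration at `r + 1` uses lifting for both at `r`, so `F`, `F̂` and the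
vanishing go through one induction. -/
theorem liftsTo (r : ℤ) (hr : 2 ≤ r) : K.F.LiftsTo K.W r := by
  suffices H : K.F.LiftsTo K.W r ∧ K.Fhat.LiftsTo K.W r ∧ K.W.VanishesAt (r - 1) from H.1
  induction r, hr using Int.leInduction with
  | base =>
    exact ⟨fun p i a x hxF hxW hdx => ⟨x, hxF, hxW, by simp, hdx⟩,
      fun p i a x hxF hxW hdx => ⟨x, hxF, hxW, by simp, hdx⟩, fun p i x hx _ =>
        ⟨x, K.W.mem_of_le (by omega) hx, by simp⟩⟩
  | succ r hr ih =>
    have h := liftsTo_succ hr ih.1 ih.2.1 ih.2.2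
    refine ⟨h, liftsTo_succ (K := K.swap) hr ih.2.1 ih.1 ih.2.2, ?_⟩
    rw [add_sub_cancel_right]
    exact VanishesAt.succ K.biregular_F hr h ih.2.2

/-! ### Cocycles, strictness of the differential and degeneration. -/

/-- Every element of `F^a ∩ W^p` whose class on the `E_1` page of `W` is killed by `d_1` is
congruent modulo `W^{p+1}` to a cocycle in `F^a`. -/
theorem exists_cocycle {p i a : ℤ} {x : K.A.X i} (hxF : x ∈ K.F i a) (hxW : x ∈ K.W i p)
    (hdx : (K.A.d i (i + 1)).hom x ∈ K.W (i + 1) (p + 2)) :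
    ∃ x' ∈ K.F i a, x' ∈ K.W i p ∧ x - x' ∈ K.W i (p + 1) ∧ (K.A.d i (i + 1)).hom x' = 0 := by
  obtain ⟨c, hc⟩ := exists_mem_eq_zero K.biregular_W (i + 1)
  -- This index makes `p + r ≥ c`, where `W` vanishes in degree `i + 1`.
  obtain ⟨x', hF, hW, hx, hd⟩ := K.liftsTo (max 2 (c - p)) (le_max_left _ _) p i a x hxF hxW hdx
  exact ⟨x', hF, hW, hx, hc _ (by omega) _ hd⟩

theorem exists_cocycle_Fhat {p i a : ℤ} {x : K.A.X i} (hxF : x ∈ K.Fhat i a) (hxW : x ∈ K.W i p)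
    (hdx : (K.A.d i (i + 1)).hom x ∈ K.W (i + 1) (p + 2)) :
    ∃ x' ∈ K.Fhat i a, x' ∈ K.W i p ∧ x - x' ∈ K.W i (p + 1) ∧ (K.A.d i (i + 1)).hom x' = 0 :=
  K.swap.exists_cocycle hxF hxW hdx

/-- The boundaries in `W^q` are differentials of elements of `W^{q-1}`. -/
theorem exists_d_eq_of_mem_W {q i : ℤ} {x : K.A.X i}
    (hdx : (K.A.d i (i + 1)).hom x ∈ K.W (i + 1) q) :
    ∃ u ∈ K.W i (q - 1), (K.A.d i (i + 1)).hom u = (K.A.d i (i + 1)).hom x := by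
  obtain ⟨a, ha⟩ := exists_le_mem K.biregular_F i
  obtain ⟨b, hb⟩ := exists_le_mem K.biregular_W i
  suffices H : ∀ (m : ℕ) (x : K.A.X i), x ∈ K.W i (q - 1 - m) →
      (K.A.d i (i + 1)).hom x ∈ K.W (i + 1) q →
      ∃ u ∈ K.W i (q - 1), (K.A.d i (i + 1)).hom u = (K.A.d i (i + 1)).hom x from
    H (q - 1 - b).toNat x (K.W.mem_of_le (by omega) (hb x)) hdx
  intro m
  induction m with
  | zero => exact fun x hx _ => ⟨x, by simpa using hx, rfl⟩
  | succ m ih =>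
    intro x hx hdx
    -- Subtracting a cocycle raises the level of `x` in `W` without changing `dx`; this works up to
    -- `W^{q-1}`, where `dx ∈ W^q` no longer makes `d_1` kill the class.
    obtain ⟨x', -, -, hx', hd⟩ := K.exists_cocycle (ha x) hx (K.W.mem_of_le (by omega) hdx)
    obtain ⟨u, hu, h⟩ := ih (x - x') (K.W.mem_of_le (by push_cast; omega) hx')
      (by rwa [map_sub, hd, sub_zero])
    exact ⟨u, hu, by rw [h, map_sub, hd, sub_zero]⟩

/-- If cocycles `α ∈ F^a ∩ W^q` and `β ∈ F̂^b ∩ W^q` have the same class in `H^i(A)` modulo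
`W^{q+1}`, with `a + b` larger than the weight, then `α` is cohomologous to a cocycle in `W^{q+1}`
by an element of `F^a`. -/
theorem exists_sub_d_mem_of_cohomologous {q j i a b : ℤ} (hji : j + 1 = i)
    (hab : i - q + 1 ≤ a + b) {α β : K.A.X i} {y : K.A.X j} (hαF : α ∈ K.F i a) (hαW : α ∈ K.W i q)
    (hdα : (K.A.d i (i + 1)).hom α = 0) (hβF : β ∈ K.Fhat i b) (hβW : β ∈ K.W i q)
    (hdβ : (K.A.d i (i + 1)).hom β = 0) (h : α - β - (K.A.d j i).hom y ∈ K.W i (q + 1)) :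
    ∃ v ∈ K.F j a, α - (K.A.d j i).hom v ∈ K.W i (q + 1) := by
  subst hji
  obtain ⟨u, hu, hdu⟩ := K.exists_d_eq_of_mem_W (q := q) (x := y) (by
    have := sub_mem (sub_mem hαW hβW) (K.W.mem_of_le (by omega : q ≤ q + 1) h)
    rwa [sub_sub_cancel] at this)
  obtain ⟨v, hvF, -, hv⟩ := K.exists_sub_d_mem rfl hab hαF hαW (hdα ▸ zero_mem _) hβF hβW
    (hdβ ▸ zero_mem _) hu (hdu ▸ h)
  exact ⟨v, hvF, hv⟩

/-- A cocycle in `F^a` that is cohomologous to an element of `W^p` is cohomologous to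
one in `F^a ∩ W^p` by an element of `F^a`. -/
theorem exists_mem_F_inf_W {p j i a : ℤ} (hji : j + 1 = i) {f : K.A.X i} {y : K.A.X j}
    (hfF : f ∈ K.F i a) (hdf : (K.A.d i (i + 1)).hom f = 0)
    (h : f - (K.A.d j i).hom y ∈ K.W i p) :
    ∃ v ∈ K.F j a, f - (K.A.d j i).hom v ∈ K.W i p := by
  obtain ⟨c, hc⟩ := exists_le_mem K.biregular_W i
  suffices H : ∀ (m : ℕ) (f : K.A.X i) (y : K.A.X j), f ∈ K.F i a → f ∈ K.W i (p - m) →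
      (K.A.d i (i + 1)).hom f = 0 → f - (K.A.d j i).hom y ∈ K.W i p →
      ∃ v ∈ K.F j a, f - (K.A.d j i).hom v ∈ K.W i p from
    H (p - c).toNat f y hfF (K.W.mem_of_le (by omega) (hc f)) hdf h
  intro m
  induction m with
  | zero => exact fun f y _ hW _ _ => ⟨0, zero_mem _, by simpa using hW⟩
  | succ m ih =>
    intro f y hF hW hd h
    -- `β = 0` lies in every `F̂^b`, so `b` is free and is chosen to reach the weight bound.
    obtain ⟨v, hv, hfv⟩ := K.exists_sub_d_mem_of_cohomologous (b := i - (p - ↑(m + 1)) + 1 - a)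
      (β := 0) (y := y) hji (by omega) hF hW hd (zero_mem _) (zero_mem _) (map_zero _)
      (by rw [sub_zero]; exact K.W.mem_of_le (by push_cast; omega) h)
    obtain ⟨v', hv', h'⟩ := ih (f - (K.A.d j i).hom v) (y - v) (sub_mem hF (K.F.d_mem _ hv))
      (K.W.mem_of_le (by push_cast; omega) hfv) (by rw [map_sub, hd, d_d_apply, sub_zero])
      (by rw [map_sub]; simpa using h)
    exact ⟨v + v', add_mem hv hv', by rwa [map_add, ← sub_sub]⟩

/-- The differential of `A` is strict for `F`. -/
theorem exists_d_eq_of_mem_F {a i : ℤ} {x : K.A.X i}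
    (hdx : (K.A.d i (i + 1)).hom x ∈ K.F (i + 1) a) :
    ∃ u ∈ K.F i a, (K.A.d i (i + 1)).hom u = (K.A.d i (i + 1)).hom x := by
  obtain ⟨c, hc⟩ := exists_mem_eq_zero K.biregular_W (i + 1)
  -- Since `W^c = 0` in this degree, being a boundary modulo `W^c` from `F^a` is being one exactly.
  obtain ⟨u, hu, h⟩ := K.exists_mem_F_inf_W (p := c) (y := x) rfl hdx (d_d_apply _ _ _ _)
    (by rw [sub_self]; exact zero_mem _)
  exact ⟨u, hu, (sub_eq_zero.1 (hc c le_rfl _ h)).symm⟩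

theorem degeneratesAt_one_F : K.F.DegeneratesAt 1 := fun r hr p n =>
  K.F.dPage_eq_zero (s := p + r) (by omega) fun _ hx => K.exists_d_eq_of_mem_F hx.2

theorem degeneratesAt_two_W : K.W.DegeneratesAt 2 := fun r hr p n =>
  K.W.dPage_eq_zero (s := p + r - 1) (by omega) fun _ hx => K.exists_d_eq_of_mem_W hx.2

/-! ### The mixed Hodge structure on cohomology. -/

theorem mem_onHomology_F_inf_W {i a p : ℤ} {c : K.A.homology i}
    (hF : c ∈ K.F.onHomology i a) (hW : c ∈ K.W.onHomology i p) :
    ∃ x : LinearMap.ker (K.A.d i (i + 1)).hom, x.1 ∈ K.F i a ∧ x.1 ∈ K.W i p ∧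
      homologyClass K.A i x = c := by
  obtain ⟨f, hf, rfl⟩ := (K.F.mem_onHomology i a c).1 hF
  obtain ⟨w, hw, hwf⟩ := (K.W.mem_onHomology i p _).1 hW
  obtain ⟨y, hy⟩ := (homologyClass_eq_zero_iff (sub_add_cancel i 1) (f - w)).1
    (by rw [map_sub, hwf, sub_self])
  obtain ⟨v, hv, h⟩ := K.exists_mem_F_inf_W (p := p) (y := y) (sub_add_cancel i 1) hf f.2
    (by rw [hy]; simpa using hw)
  have hd : (K.A.d i (i + 1)).hom (f.1 - (K.A.d (i - 1) i).hom v) = 0 := by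
    rw [map_sub, d_d_apply, sub_zero]
    exact f.2
  refine ⟨⟨_, hd⟩, sub_mem hf (K.F.d_mem _ hv), h, ?_⟩
  rw [← sub_eq_zero, ← map_sub]
  exact (homologyClass_eq_zero_iff (sub_add_cancel i 1) _).2 ⟨-v, by simp⟩

theorem mem_onHomology_Fhat_inf_W {i a p : ℤ} {c : K.A.homology i}
    (hF : c ∈ K.Fhat.onHomology i a) (hW : c ∈ K.W.onHomology i p) :
    ∃ x : LinearMap.ker (K.A.d i (i + 1)).hom, x.1 ∈ K.Fhat i a ∧ x.1 ∈ K.W i p ∧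
      homologyClass K.A i x = c :=
  K.swap.mem_onHomology_F_inf_W hF hW

theorem isCompl_grInduced (i k a b : ℤ) (hab : a + b = -k + 1) :
    IsCompl (grInduced (fun k => K.W.onHomology i (k + i)) (K.F.onHomology i) k a)
      (grInduced (fun k => K.W.onHomology i (k + i)) (K.Fhat.onHomology i) k b) := by
  have hk : k + 1 + i = k + i + 1 := by ring
  constructor
  · rw [disjoint_iff, eq_bot_iff]
    rintro _ ⟨⟨⟨c₁, hcW₁⟩, hcF₁, rfl⟩, ⟨⟨c₂, hcW₂⟩, hcF₂, h⟩⟩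
    replace hcF₁ : c₁ ∈ K.F.onHomology i a := hcF₁
    replace hcF₂ : c₂ ∈ K.Fhat.onHomology i b := hcF₂
    have h' : c₂ - c₁ ∈ K.W.onHomology i (k + 1 + i) :=
      (Submodule.Quotient.eq (((fun k => K.W.onHomology i (k + i)) (k + 1)).submoduleOf _)).1 h
    refine (Submodule.Quotient.mk_eq_zero _).2 ?_
    change c₁ ∈ K.W.onHomology i (k + 1 + i)
    rw [hk] at h' ⊢
    obtain ⟨x₁, hF₁, hW₁, rfl⟩ := K.mem_onHomology_F_inf_W hcF₁ hcW₁
    obtain ⟨x₂, hF₂, hW₂, rfl⟩ := K.mem_onHomology_Fhat_inf_W hcF₂ hcW₂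
    obtain ⟨w, hw, hwx⟩ := (K.W.mem_onHomology i _ _).1 h'
    obtain ⟨y, hy⟩ := (homologyClass_eq_zero_iff (A := K.A) (sub_add_cancel i 1) (x₁ - x₂ + w)).1
      (by
        rw [map_add, map_sub, hwx]
        exact sub_add_sub_cancel' _ _ _ |>.trans (sub_self _))
    replace hy : (K.A.d (i - 1) i).hom y = x₁.1 - x₂.1 + w.1 := hy
    -- The shift in `W` matches weights: `i - (k + i) = -k`, which `a + b` exceeds by one.
    obtain ⟨v, hv, hx⟩ := K.exists_sub_d_mem_of_cohomologous (q := k + i) (y := y)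
      (sub_add_cancel i 1) (by omega) hF₁ hW₁ x₁.2 hF₂ hW₂ x₂.2 (by
        rw [hy]
        convert neg_mem hw using 1
        abel)
    have hd : (K.A.d i (i + 1)).hom (x₁.1 - (K.A.d (i - 1) i).hom v) = 0 := by
      rw [map_sub, d_d_apply, sub_zero]
      exact x₁.2
    refine (K.W.mem_onHomology i _ _).2 ⟨⟨_, hd⟩, hx, ?_⟩
    rw [← sub_eq_zero, ← map_sub]
    exact (homologyClass_eq_zero_iff (sub_add_cancel i 1) _).2 ⟨-v, by simp⟩
  · rw [codisjoint_iff, eq_top_iff]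
    rintro z -
    obtain ⟨⟨c, hc⟩, rfl⟩ := Submodule.mkQ_surjective _ z
    obtain ⟨x, hx, rfl⟩ := (K.W.mem_onHomology i _ _).1 hc
    have hdx : (K.A.d i (i + 1)).hom x.1 = 0 := x.2
    obtain ⟨x₁, x₂, y, hF₁, hW₁, hd₁, hF₂, hW₂, hd₂, hy, hw⟩ :=
      K.exists_decomposition_ker (a := a) (b := b) (sub_add_cancel i 1) (by omega) hx
        (hdx ▸ zero_mem _)
    -- The two components survive `d_1`, so they lift to cocycles of `A` within `F^a` and `F̂^b`.
    obtain ⟨f, hfF, hfW, hf, hdf⟩ := K.exists_cocycle hF₁ hW₁ hd₁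
    obtain ⟨g, hgF, hgW, hg, hdg⟩ := K.exists_cocycle_Fhat hF₂ hW₂ hd₂
    let f' : LinearMap.ker (K.A.d i (i + 1)).hom := ⟨f, hdf⟩
    let g' : LinearMap.ker (K.A.d i (i + 1)).hom := ⟨g, hdg⟩
    have hf' : homologyClass K.A i f' ∈ K.W.onHomology i (k + i) :=
      (K.W.mem_onHomology i _ _).2 ⟨f', hfW, rfl⟩
    have hg' : homologyClass K.A i g' ∈ K.W.onHomology i (k + i) :=
      (K.W.mem_onHomology i _ _).2 ⟨g', hgW, rfl⟩
    refine Submodule.mem_sup.2 ⟨_, ⟨⟨_, hf'⟩, (K.F.mem_onHomology i _ _).2 ⟨f', hfF, rfl⟩, rfl⟩,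
      _, ⟨⟨_, hg'⟩, (K.Fhat.mem_onHomology i _ _).2 ⟨g', hgF, rfl⟩, rfl⟩, ?_⟩
    refine (Submodule.Quotient.eq
      (((fun k => K.W.onHomology i (k + i)) (k + 1)).submoduleOf _)).2 ?_
    change homologyClass K.A i f' + homologyClass K.A i g' - homologyClass K.A i x ∈
      K.W.onHomology i (k + 1 + i)
    rw [hk, ← map_add, ← map_sub]
    have hd : (K.A.d i (i + 1)).hom (f + g - x.1 + (K.A.d (i - 1) i).hom y) = 0 := by
      rw [map_add, map_sub, map_add, d_d_apply, hdf, hdg, hdx]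
      simp
    refine (K.W.mem_onHomology i _ _).2 ⟨⟨_, hd⟩, ?_, ?_⟩
    · change f + g - x.1 + (K.A.d (i - 1) i).hom y ∈ K.W i (k + i + 1)
      convert neg_mem (add_mem (add_mem hw hf) hg) using 1
      abel
    · rw [← sub_eq_zero, ← map_sub]
      exact (homologyClass_eq_zero_iff (sub_add_cancel i 1) _).2 ⟨y, by simp [f', g']⟩

theorem isPureHodge_grInduced (i k : ℤ) :
    IsPureHodge (grInduced (fun k => K.W.onHomology i (k + i)) (K.F.onHomology i) k)
      (grInduced (fun k => K.W.onHomology i (k + i)) (K.Fhat.onHomology i) k) (-k) where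
  finiteDimensional := by
    have := K.finite_homology i
    exact Module.Finite.of_surjective (Submodule.mkQ _) (Submodule.mkQ_surjective _)
  finite_F := (Filtration.onHomology_finite K.biregular_F i).grInduced _ k
  finite_Fhat := (Filtration.onHomology_finite K.biregular_Fhat i).grInduced _ k
  opposed := K.isCompl_grInduced i k

theorem isMixedHodge_homology (i : ℤ) :
    IsMixedHodge (K.F.onHomology i) (K.Fhat.onHomology i) (fun k => K.W.onHomology i (k + i)) where
  finiteDimensional := K.finite_homology i
  finite_F := Filtration.onHomology_finite K.biregular_F i
  finite_Fhat := Filtration.onHomology_finite K.biregular_Fhat i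
  finite_W := (Filtration.onHomology_finite K.biregular_W i).shift i
  pure_gr := K.isPureHodge_grInduced i

end HodgeComplex

end CHodge

theorem theorem1 (K : CHodge.HodgeComplex.{u}) :
    K.W.DegeneratesAt 2 ∧
    (∀ i : ℤ, CHodge.IsMixedHodge (K.F.onHomology i) (K.Fhat.onHomology i)
      (fun k => K.W.onHomology i (k + i))) ∧
    (K.F.DegeneratesAt 1 ∧ K.Fhat.DegeneratesAt 1) :=
  ⟨K.degeneratesAt_two_W, K.isMixedHodge_homology, K.degeneratesAt_one_F,
    K.swap.degeneratesAt_one_F⟩
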